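/- **Proposition (Rate of convergence of the variance-reduced stochastic proximal-point scheme under maximal monotonicity).** Let $\Phi(\cdot,\omega):\mathbb{R}^n\rightrightarrows\mathbb{R}^n$ be a random set-valued map, where $\omega$ has law $\mu$, and let $T(x)=\mathbb{E}[\Phi(x,\omega)]$ be its (Aumann) expectation, i.e. the set of integrals of integrable selections of $\Phi(x,\cdot)$. (This includes the map $\Phi(x,\omega)=\prod_i\big[\partial_{x^i}\tilde f_i(x^i,x^{-i},y^i(x,\omega),\omega)+\mathcal N_{\mathcal X_i}(x^i)\big]$ of a stochastic hierarchical game.) Assume that $T$ is maximal monotone and that $0\in T(x)$ has a solution. Assume that there is a measurable stochastic first-order oracle $v(x,\omega)$ and constants $M_1,M_2$ such that, for all $x$ in a set $D\subseteq\mathbb{R}^n$ (for instance $D=\mathbb{R}^n$), $$v(x,\omega)\in\Phi(x,\omega)\ \text{a.s.},\qquad \mathbb{E}[v(x,\omega)]\in T(x),\qquad \mathbb{E}\big[\|v(x,\omega)\|^2\big]\le M_1^2\|x\|^2+M_2^2 .$$ Let $\lambda>0$, $a>1$, $N_k=\lceil (k+1)^{2a}\rceil$ for $k\ge 0$, let $\theta>\lambda$,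 and let $\alpha_0\ge 0$ and $\alpha_j=\theta/j$ for $j\ge1$. Given $x^0\in\mathbb{R}^n$, the scheme generates $x^{k+1}$ from $x^k$ by $N_k$ stochastic approximation steps for the resolvent problem $0\in T(z)+\tfrac1\lambda(z-x^k)$: $$z^k_0=x^k,\qquad z^k_{j+1}=z^k_j-\alpha_j\Big(v(z^k_j,\omega_{k,j})+\tfrac1\lambda(z^k_j-x^k)\Big)\quad(j=0,\dots,N_k-1),\qquad x^{k+1}=z^k_{N_k},$$ where the samples $\omega_{k,j}$ are independent with law $\mu$; each step makes one oracle call, and all the query points $z^k_j$, $0\le j<N_k$, are assumed to lie in $D$ almost surely (which is no condition if $D=\mathbb{R}^n$). Let $J_\lambda^T=(I+\lambda T)^{-1}$ be the resolvent, which is single-valued and defined on all of $\mathbb{R}^n$, and let $T_\lambda=\tfrac1\lambda(I-J_\lambda^T)$ be the Yosida approximation of $T$. Then the following hold. (a) There is a constant $C$ such that $\mathbb{E}\big[\|T_\lambda(x^k)\|^2\big]\le \dfrac{C}{k+1}$ for all $k\ge0$ (in particular the expectation is finite). (b) There is a constant $C$ such that for every $\epsilon\in(0,1]$ there is a $K$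 with $\mathbb{E}\big[\|T_\lambda(x^{K+1})\|^2\big]\le\epsilon$ and such that the number of oracle calls made to compute $x^{K+1}$ satisfies $$\sum_{k=0}^{K}N_k\le \frac{C}{\epsilon^{2a+1}} .$$ -/

import Mathlib

open MeasureTheory ProbabilityTheory

namespace VRSPP

section Operators

variable {E : Type*} [NormedAddCommGroup E] [InnerProductSpace ℝ E]

/-- A set-valued operator `T : E ⇉ E` is monotone. -/
def IsMonotoneOp (T : E → Set E) : Prop :=
  ∀ x y u w : E, u ∈ T x → w ∈ T y → 0 ≤ inner ℝ (u - w) (x - y)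

/-- A set-valued operator is maximal monotone: it is monotone and its graph is not properly
contained in the graph of another monotone operator. -/
def IsMaximalMonotone (T : E → Set E) : Prop :=
  IsMonotoneOp T ∧
    ∀ T' : E → Set E, IsMonotoneOp T' → (∀ x, T x ⊆ T' x) → ∀ x, T' x ⊆ T x

/-- The set-valued inverse `(I + lam T)⁻¹`: the set of all `z` with `x ∈ z + lam T(z)`. -/
def resolventSet (T : E → Set E) (lam : ℝ) (x : E) : Set E :=
  {z | ∃ u ∈ T z, z + lam • u = x}

/-- The resolvent `J = (I + lam T)⁻¹` as a map: a chosen element of `resolventSet T lam x`. For a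
maximal monotone `T` and `lam > 0` on a finite-dimensional space, that set is a singleton. -/
noncomputable def resolvent (T : E → Set E) (lam : ℝ) (x : E) : E :=
  Classical.epsilon fun z => z ∈ resolventSet T lam x

/-- The Yosida approximation `(I - J) / lam`. -/
noncomputable def yosida (T : E → Set E) (lam : ℝ) (x : E) : E :=
  lam⁻¹ • (x - resolvent T lam x)

end Operators

section Stochastic

variable {E S : Type*} [NormedAddCommGroup E] [InnerProductSpace ℝ E]
  [MeasurableSpace E] [MeasurableSpace S]

/-- The expectation `T(x) = 𝔼[Φ(x, ω)]` of a set-valued random map, in the sense of Aumann: the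
set of the integrals of all integrable selections of `Φ(x, ·)`. -/
def expectedMap (μ : Measure S) (Φ : E → S → Set E) (x : E) : Set E :=
  {y | ∃ g : S → E, Integrable g μ ∧ (∀ᵐ s ∂μ, g s ∈ Φ x s) ∧ ∫ s, g s ∂μ = y}

/-- `v` is a stochastic first-order oracle for `T = 𝔼[Φ(·, ω)]` on the set `D` of points at which
it can be queried, with state-dependent second-moment bound `M₁² ‖x‖² + M₂²`. -/
structure IsOracle (μ : Measure S) (Φ : E → S → Set E) (D : Set E) (v : E → S → E)
    (M₁ M₂ : ℝ) : Prop where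
  measurable : Measurable (Function.uncurry v)
  mem : ∀ x ∈ D, ∀ᵐ s ∂μ, v x s ∈ Φ x s
  memLp : ∀ x ∈ D, MemLp (v x) 2 μ
  mean_mem : ∀ x ∈ D, ∫ s, v x s ∂μ ∈ expectedMap μ Φ x
  second_moment : ∀ x ∈ D, ∫ s, ‖v x s‖ ^ 2 ∂μ ≤ M₁ ^ 2 * ‖x‖ ^ 2 + M₂ ^ 2

end Stochastic

section Scheme

variable {E S : Type*} [NormedAddCommGroup E] [InnerProductSpace ℝ E]

/-- The inner stochastic approximation scheme for the resolvent problem at `x`, started at `x`,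
with step lengths `α` and samples `s 0, s 1, …`; every step makes one oracle call. -/
noncomputable def saIter (v : E → S → E) (lam : ℝ) (α : ℕ → ℝ) (x : E) (s : ℕ → S) : ℕ → E
  | 0 => x
  | j + 1 => saIter v lam α x s j -
      α j • (v (saIter v lam α x s j) (s j) + lam⁻¹ • (saIter v lam α x s j - x))

/-- The outer iterates `x⁰, x¹, …`: the `k`-th outer step makes `N k` inner steps from `xᵏ`, with
the samples `s k 0, …, s k (N k - 1)`, and returns the last inner iterate. -/
noncomputable def iterate (v : E → S → E) (lam : ℝ) (α : ℕ → ℝ) (N : ℕ → ℕ) (x₀ : E)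
    (s : ℕ → ℕ → S) : ℕ → E
  | 0 => x₀
  | k + 1 => saIter v lam α (iterate v lam α N x₀ s k) (s k) (N k)

/-- The inner iterate `z` with outer index `k` and inner index `j`. -/
noncomputable def innerIterate (v : E → S → E) (lam : ℝ) (α : ℕ → ℝ) (N : ℕ → ℕ) (x₀ : E)
    (s : ℕ → ℕ → S) (k j : ℕ) : E :=
  saIter v lam α (iterate v lam α N x₀ s k) (s k) j

/-- The sample sizes `⌈(k + 1) ^ (2 a)⌉`. -/
noncomputable def sampleSize (a : ℝ) (k : ℕ) : ℕ := ⌈((k : ℝ) + 1) ^ (2 * a)⌉₊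

end Scheme

end VRSPP

/-!
The scheme is an inexact proximal-point method, and the rate of the exact method survives because
the errors of the inner loops are summable in mean square even after weighting by `k`.

Minty's theorem (`VRSPP.resolventSet_nonempty`) gives the resolvent `J` on the whole space. The
Cayley transform turns the monotone graph into a nonexpansive map, and the missing point comes from
a one-point extension of that map (`VRSPP.exists_forall_norm_sub_le`).

Fix an outer iterate `x`. The mean field of the oracle is a selection of the monotone `T`, so one
inner step contracts the mean squared distance to `J x` by `1 - 2 α_j / lam + O(α_j²)` up to a
perturbation `O(α_j²)` relative to `E ‖x - x₁‖² + 1`, where `x₁` is a zero of `T`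
(`VRSPP.integral_saStep_le`). Only unconditional expectations are needed: each sample is independent
of the iterates computed before it, so it is integrated out by Fubini's theorem. As `θ > lam`,
Chung's lemma (`VRSPP.exists_le_div_of_recursion`) bounds the error of the `k`-th inner loop by
`O(1 / N_k) = O((k + 1) ^ (-2 a))`.

For the outer loop, firm nonexpansiveness of `J` gives, with `τ_k = (k + 1) ^ (-a)` summable,
`E ‖x_{k+1} - x₁‖² + 1 ≤ (1 + O(τ_k)) (E ‖x_k - x₁‖² + 1) - lam² E ‖Y x_k‖²`, where `Y` is the
Yosida approximation. Hence the distances to `x₁` are bounded and `∑ E ‖Y x_k‖² < ∞`. This becomes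
the rate `O(1 / k)` because `E ‖Y x_k‖²` is almost decreasing: cocoercivity of `Y` yields
`‖Y x'‖² ≤ ‖Y x‖² + ‖x' - J x‖² / lam²` (`VRSPP.norm_yosida_sq_le_add`). The error enters here only
to second order, so the increments are `O(k ^ (-2 a))` and `∑ k · k ^ (-2 a) < ∞` for every `a > 1`;
a first-order error term would lose this for `a` close to `1`.
-/

namespace VRSPP

section Operators

variable {E : Type*} [NormedAddCommGroup E] [InnerProductSpace ℝ E]

/-! ### Extension of nonexpansive maps by one point -/

theorem sum_sum_mul_norm_sub_sq {ι : Type*} [Fintype ι] (w : ι → ℝ) (hw : ∑ i, w i = 1)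
    (f : ι → E) :
    ∑ i, ∑ j, w i * w j * ‖f i - f j‖ ^ 2 =
      2 * (∑ i, w i * ‖f i‖ ^ 2 - ‖∑ i, w i • f i‖ ^ 2) := by
  have h1 : ∑ i, ∑ j, w i * w j * ‖f i‖ ^ 2 = ∑ i, w i * ‖f i‖ ^ 2 := by
    refine Finset.sum_congr rfl fun i _ => ?_
    rw [← Finset.sum_mul, ← Finset.mul_sum, hw, mul_one]
  have h2 : ∑ i, ∑ j, w i * w j * ‖f j‖ ^ 2 = ∑ i, w i * ‖f i‖ ^ 2 := by
    rw [Finset.sum_comm, ← h1]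
    exact Finset.sum_congr rfl fun i _ => Finset.sum_congr rfl fun j _ => by ring
  have h3 : ‖∑ i, w i • f i‖ ^ 2 = ∑ i, ∑ j, w i * w j * inner ℝ (f i) (f j) := by
    rw [← real_inner_self_eq_norm_sq, sum_inner]
    refine Finset.sum_congr rfl fun i _ => ?_
    rw [inner_sum]
    refine Finset.sum_congr rfl fun j _ => ?_
    rw [real_inner_smul_left, real_inner_smul_right]
    ring
  have h4 : ∑ i, ∑ j, w i * w j * ‖f i - f j‖ ^ 2 =
      ∑ i, ∑ j, w i * w j * ‖f i‖ ^ 2 + ∑ i, ∑ j, w i * w j * ‖f j‖ ^ 2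
        - 2 * ∑ i, ∑ j, w i * w j * inner ℝ (f i) (f j) := by
    simp only [Finset.mul_sum, ← Finset.sum_add_distrib, ← Finset.sum_sub_distrib]
    refine Finset.sum_congr rfl fun i _ => Finset.sum_congr rfl fun j _ => ?_
    rw [norm_sub_sq_real]
    ring
  rw [h4, h1, h2, h3]
  ring

/-- A nonexpansive map `p i ↦ c i` between finite families extends to the point `0`. The image of
`0` is the barycentre of the `c i` for weights that maximize the dual objective
`∑ w i (‖c i‖² - ‖p i‖²) - ‖∑ w i c i‖²` of the problem of minimizing `max (‖z - c i‖² - ‖p i‖²)`;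
nonexpansiveness makes this objective nonpositive. -/
theorem exists_forall_norm_sub_le_of_fintype {ι : Type*} [Fintype ι] (c p : ι → E)
    (h : ∀ i j, ‖c i - c j‖ ≤ ‖p i - p j‖) : ∃ z : E, ∀ i, ‖z - c i‖ ≤ ‖p i‖ := by
  classical
  rcases isEmpty_or_nonempty ι with hι | hι
  · exact ⟨0, fun i => hι.elim i⟩
  set L : (ι → ℝ) → ℝ := fun w => ∑ i, w i * (‖c i‖ ^ 2 - ‖p i‖ ^ 2) with hL
  set b : (ι → ℝ) → E := fun w => ∑ i, w i • c i with hb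
  have hcont : Continuous fun w => L w - ‖b w‖ ^ 2 := by
    simp only [hL, hb]
    fun_prop
  obtain ⟨w, hw, hmax⟩ := (isCompact_stdSimplex ℝ ι).exists_isMaxOn
    ⟨_, single_mem_stdSimplex ℝ hι.some⟩ hcont.continuousOn
  have hneg : L w - ‖b w‖ ^ 2 ≤ 0 := by
    have h1 := sum_sum_mul_norm_sub_sq w hw.2 c
    have h2 := sum_sum_mul_norm_sub_sq w hw.2 p
    have h3 : ∑ i, ∑ j, w i * w j * ‖c i - c j‖ ^ 2 ≤ ∑ i, ∑ j, w i * w j * ‖p i - p j‖ ^ 2 := by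
      refine Finset.sum_le_sum fun i _ => Finset.sum_le_sum fun j _ => ?_
      have := mul_nonneg (hw.1 i) (hw.1 j)
      gcongr
      exact h i j
    have h4 : L w = ∑ i, w i * ‖c i‖ ^ 2 - ∑ i, w i * ‖p i‖ ^ 2 := by
      simp only [hL, mul_sub, Finset.sum_sub_distrib]
    have h5 := sq_nonneg ‖∑ i, w i • p i‖
    simp only [hb]
    linarith
  refine ⟨b w, fun i => ?_⟩
  -- The first-order optimality condition of `w` in the direction of the `i`-th vertex.
  have hopt : ‖c i‖ ^ 2 - ‖p i‖ ^ 2 - L w - 2 * inner ℝ (b w) (c i - b w) ≤ 0 := by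
    have hseg : ∀ t : ℝ, 0 < t → t ≤ 1 →
        ‖c i‖ ^ 2 - ‖p i‖ ^ 2 - L w - 2 * inner ℝ (b w) (c i - b w) ≤ t * ‖c i - b w‖ ^ 2 := by
      intro t ht0 ht1
      have hmem : (1 - t) • w + t • Pi.single i 1 ∈ stdSimplex ℝ ι :=
        convex_stdSimplex ℝ ι hw (single_mem_stdSimplex ℝ i) (by linarith) ht0.le (by ring)
      have hLt : L ((1 - t) • w + t • Pi.single i 1) =
          (1 - t) * L w + t * (‖c i‖ ^ 2 - ‖p i‖ ^ 2) := by
        simp only [hL, Pi.add_apply, Pi.smul_apply, smul_eq_mul, add_mul, Finset.sum_add_distrib,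
          Finset.mul_sum, mul_assoc]
        congr 1
        rw [Finset.sum_eq_single i] <;> simp +contextual
      have hbt : b ((1 - t) • w + t • Pi.single i 1) = b w + t • (c i - b w) := by
        have : ∑ j, (t * (Pi.single i 1 : ι → ℝ) j) • c j = t • c i := by
          rw [Finset.sum_eq_single i] <;> simp +contextual
        have hw' : ∑ j, ((1 - t) * w j) • c j = (1 - t) • ∑ j, w j • c j := by
          simp only [mul_smul, Finset.smul_sum]
        simp only [hb, Pi.add_apply, Pi.smul_apply, smul_eq_mul, add_smul, Finset.sum_add_distrib,
          this, hw']
        module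
      have hle := hmax hmem
      simp only [Set.mem_ofPred_eq, hLt, hbt, norm_add_sq_real, real_inner_smul_right,
        norm_smul, mul_pow, Real.norm_eq_abs, sq_abs] at hle
      refine le_of_mul_le_mul_left ?_ ht0
      linarith
    by_contra! hpos
    set δ := ‖c i‖ ^ 2 - ‖p i‖ ^ 2 - L w - 2 * inner ℝ (b w) (c i - b w)
    have hden : 0 < ‖c i - b w‖ ^ 2 + δ + 1 := by positivity
    have h1 := hseg (δ / (‖c i - b w‖ ^ 2 + δ + 1)) (by positivity) (by
      rw [div_le_one hden]
      nlinarith [sq_nonneg ‖c i - b w‖])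
    rw [div_mul_eq_mul_div, le_div_iff₀ hden] at h1
    nlinarith
  have hexp : ‖b w - c i‖ ^ 2 ≤ ‖p i‖ ^ 2 := by
    rw [inner_sub_right, real_inner_self_eq_norm_sq] at hopt
    rw [norm_sub_sq_real]
    linarith
  exact le_of_sq_le_sq hexp (norm_nonneg _)

theorem exists_forall_norm_sub_le [ProperSpace E] {ι : Type*} (c p : ι → E)
    (h : ∀ i j, ‖c i - c j‖ ≤ ‖p i - p j‖) : ∃ z : E, ∀ i, ‖z - c i‖ ≤ ‖p i‖ := by
  classical
  rcases isEmpty_or_nonempty ι with hι | ⟨⟨i₀⟩⟩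
  · exact ⟨0, fun i => hι.elim i⟩
  obtain ⟨z, -, hz⟩ := (isCompact_closedBall (c i₀) ‖p i₀‖).inter_iInter_nonempty
    (fun i => Metric.closedBall (c i) ‖p i‖) (fun _ => Metric.isClosed_closedBall) (by
      intro u
      obtain ⟨z, hz⟩ := exists_forall_norm_sub_le_of_fintype
        (fun i : (insert i₀ u : Finset ι) => c i) (fun i => p i) fun i j => h i j
      refine ⟨z, mem_closedBall_iff_norm.2 (hz ⟨i₀, Finset.mem_insert_self _ _⟩),
        Set.mem_iInter₂.2 fun i hi => ?_⟩
      exact mem_closedBall_iff_norm.2 (hz ⟨i, Finset.mem_insert_of_mem hi⟩))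
  exact ⟨z, fun i => mem_closedBall_iff_norm.1 (Set.mem_iInter.1 hz i)⟩

/-! ### The resolvent and the Yosida approximation -/

/-- Minty's theorem. The Cayley transform `ξ + u ↦ ξ - u` of the graph is nonexpansive, and
extending it by one point amounts to finding a pair that is monotonically related to the graph. -/
theorem resolventSet_nonempty [ProperSpace E] {T : E → Set E} (hT : IsMaximalMonotone T)
    {lam : ℝ} (hlam : 0 < lam) (x : E) : (resolventSet T lam x).Nonempty := by
  obtain ⟨z, hz⟩ := exists_forall_norm_sub_le
    (fun q : {q : E × E // q.2 ∈ T q.1} => (2⁻¹ : ℝ) • (q.1.1 - (lam • q.1.2 - x)))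
    (fun q => (2⁻¹ : ℝ) • (q.1.1 + (lam • q.1.2 - x))) (by
      rintro ⟨⟨y, u⟩, hu⟩ ⟨⟨y', u'⟩, hu'⟩
      have hm : 0 ≤ inner ℝ (y - y') (lam • (u - u')) := by
        rw [real_inner_smul_right, real_inner_comm]
        exact mul_nonneg hlam.le (hT.1 _ _ _ _ hu hu')
      simp only [← smul_sub, norm_smul]
      refine mul_le_mul_of_nonneg_left (le_of_sq_le_sq ?_ (norm_nonneg _)) (norm_nonneg _)
      have e1 : y - (lam • u - x) - (y' - (lam • u' - x)) = (y - y') - lam • (u - u') := by module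
      have e2 : y + (lam • u - x) - (y' + (lam • u' - x)) = (y - y') + lam • (u - u') := by module
      rw [e1, e2, norm_sub_sq_real, norm_add_sq_real]
      linarith)
  have hrel : ∀ y u, u ∈ T y → 0 ≤ inner ℝ (u - lam⁻¹ • (x - z)) (y - z) := by
    intro y u hu
    have h1 := pow_le_pow_left₀ (norm_nonneg _) (hz ⟨(y, u), hu⟩) 2
    set u' := lam • u - x with hu'
    rw [norm_sub_sq_real, norm_smul, norm_smul, mul_pow, mul_pow, norm_sub_sq_real,
      norm_add_sq_real, real_inner_smul_right, inner_sub_right] at h1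
    have e : u - lam⁻¹ • (x - z) = lam⁻¹ • (u' + z) := by
      rw [hu', smul_add, smul_sub, smul_sub, inv_smul_smul₀ hlam.ne']
      abel
    rw [e, real_inner_smul_left]
    refine mul_nonneg (inv_nonneg.2 hlam.le) ?_
    rw [inner_add_left, inner_sub_right, inner_sub_right, real_inner_self_eq_norm_sq,
      real_inner_comm y u', real_inner_comm z u']
    norm_num at h1
    linarith
  refine ⟨z, lam⁻¹ • (x - z), ?_, ?_⟩
  · refine hT.2 (fun y => T y ∪ {u | y = z ∧ u = lam⁻¹ • (x - z)}) ?_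
      (fun y => Set.subset_union_left) z (Or.inr ⟨rfl, rfl⟩)
    rintro y y' u u' (hu | ⟨rfl, rfl⟩) (hu' | ⟨rfl, rfl⟩)
    · exact hT.1 _ _ _ _ hu hu'
    · exact hrel _ _ hu
    · rw [← neg_sub u', ← neg_sub y', inner_neg_neg]
      exact hrel _ _ hu'
    · simp
  · rw [smul_inv_smul₀ hlam.ne']
    abel

variable {T : E → Set E} {lam : ℝ}

theorem resolvent_mem [ProperSpace E] (hT : IsMaximalMonotone T) (hlam : 0 < lam) (x : E) :
    resolvent T lam x ∈ resolventSet T lam x :=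
  Classical.epsilon_spec (resolventSet_nonempty hT hlam x)

theorem yosida_mem [ProperSpace E] (hT : IsMaximalMonotone T) (hlam : 0 < lam) (x : E) :
    yosida T lam x ∈ T (resolvent T lam x) := by
  obtain ⟨u, hu, h⟩ := resolvent_mem hT hlam x
  have : yosida T lam x = u := by
    rw [yosida, ← eq_sub_of_add_eq' h, inv_smul_smul₀ hlam.ne']
  exact this ▸ hu

theorem smul_yosida (hlam : 0 < lam) (x : E) :
    lam • yosida T lam x = x - resolvent T lam x :=
  smul_inv_smul₀ hlam.ne' _

theorem eq_of_mem_resolventSet (hT : IsMonotoneOp T) (hlam : 0 < lam) {x z z' : E}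
    (hz : z ∈ resolventSet T lam x) (hz' : z' ∈ resolventSet T lam x) : z = z' := by
  obtain ⟨u, hu, h⟩ := hz
  obtain ⟨u', hu', h'⟩ := hz'
  have h1 := hT _ _ _ _ hu hu'
  have h2 : z - z' = -(lam • (u - u')) := by
    have := h.trans h'.symm
    rw [smul_sub, neg_sub, sub_eq_sub_iff_add_eq_add, this, add_comm]
  rw [h2, inner_neg_right, real_inner_smul_right, real_inner_self_eq_norm_sq] at h1
  have h3 : u - u' = 0 := by
    rw [← norm_eq_zero, ← sq_eq_zero_iff]
    nlinarith [sq_nonneg ‖u - u'‖]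
  rw [← sub_eq_zero, h2, h3, smul_zero, neg_zero]

theorem resolventSet_eq_singleton [ProperSpace E] (hT : IsMaximalMonotone T) (hlam : 0 < lam)
    (x : E) : resolventSet T lam x = {resolvent T lam x} :=
  Set.eq_singleton_iff_unique_mem.2 ⟨resolvent_mem hT hlam x,
    fun _ hz => eq_of_mem_resolventSet hT.1 hlam hz (resolvent_mem hT hlam x)⟩

theorem resolvent_eq_self [ProperSpace E] (hT : IsMaximalMonotone T) (hlam : 0 < lam) {x : E}
    (hx : 0 ∈ T x) : resolvent T lam x = x :=
  eq_of_mem_resolventSet hT.1 hlam (resolvent_mem hT hlam x) ⟨0, hx, by simp⟩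

theorem inner_yosida_sub_resolvent_sub_nonneg [ProperSpace E] (hT : IsMaximalMonotone T)
    (hlam : 0 < lam) (x y : E) :
    0 ≤ inner ℝ (yosida T lam x - yosida T lam y) (resolvent T lam x - resolvent T lam y) :=
  hT.1 _ _ _ _ (yosida_mem hT hlam x) (yosida_mem hT hlam y)

/-- The resolvent is firmly nonexpansive. -/
theorem norm_resolvent_sub_sq_add_le [ProperSpace E] (hT : IsMaximalMonotone T)
    (hlam : 0 < lam) (x y : E) :
    ‖resolvent T lam x - resolvent T lam y‖ ^ 2 +
      lam ^ 2 * ‖yosida T lam x - yosida T lam y‖ ^ 2 ≤ ‖x - y‖ ^ 2 := by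
  have h := inner_yosida_sub_resolvent_sub_nonneg hT hlam x y
  have e : x - y = (resolvent T lam x - resolvent T lam y) +
      lam • (yosida T lam x - yosida T lam y) := by
    rw [smul_sub, smul_yosida hlam, smul_yosida hlam]
    abel
  rw [e, norm_add_sq_real, norm_smul, mul_pow, Real.norm_eq_abs, sq_abs, real_inner_smul_right,
    real_inner_comm]
  have := mul_nonneg hlam.le h
  linarith

theorem norm_resolvent_sub_sq_add_le_of_zero_mem [ProperSpace E] (hT : IsMaximalMonotone T)
    (hlam : 0 < lam) {x₁ : E} (hx₁ : 0 ∈ T x₁) (x : E) :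
    ‖resolvent T lam x - x₁‖ ^ 2 + lam ^ 2 * ‖yosida T lam x‖ ^ 2 ≤ ‖x - x₁‖ ^ 2 := by
  have h := norm_resolvent_sub_sq_add_le hT hlam x x₁
  have hy : yosida T lam x₁ = 0 := by simp [yosida, resolvent_eq_self hT hlam hx₁]
  rwa [resolvent_eq_self hT hlam hx₁, hy, sub_zero] at h

theorem continuous_resolvent [ProperSpace E] (hT : IsMaximalMonotone T) (hlam : 0 < lam) :
    Continuous (resolvent T lam) := by
  refine LipschitzWith.continuous (K := 1) (LipschitzWith.of_dist_le_mul fun x y => ?_)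
  rw [NNReal.coe_one, one_mul, dist_eq_norm, dist_eq_norm]
  refine le_of_sq_le_sq ?_ (norm_nonneg _)
  have := norm_resolvent_sub_sq_add_le hT hlam x y
  nlinarith [sq_nonneg (lam * ‖yosida T lam x - yosida T lam y‖)]

theorem continuous_yosida [ProperSpace E] (hT : IsMaximalMonotone T) (hlam : 0 < lam) :
    Continuous (yosida T lam) :=
  (continuous_id.sub (continuous_resolvent hT hlam)).const_smul _

/-- An inexact proximal step increases `‖yosida T lam ·‖²` at most by a multiple of the square of
the error. The absence of a term of first order in the error is due to the cocoercivity of the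
Yosida approximation, of which the step is a forward step. -/
theorem norm_yosida_sq_le_add [ProperSpace E] (hT : IsMaximalMonotone T) (hlam : 0 < lam)
    (x x' : E) :
    ‖yosida T lam x'‖ ^ 2 ≤ ‖yosida T lam x‖ ^ 2 + (lam ^ 2)⁻¹ * ‖x' - resolvent T lam x‖ ^ 2 := by
  have h := inner_yosida_sub_resolvent_sub_nonneg hT hlam x' x
  set Y := yosida T lam x with hY
  set d := yosida T lam x' - Y with hd
  set e := x' - resolvent T lam x with he
  have e1 : resolvent T lam x' - resolvent T lam x = e - lam • (d + Y) := by
    rw [hd, sub_add_cancel, smul_yosida hlam, he]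
    abel
  rw [e1, inner_sub_right, real_inner_smul_right, inner_add_right, real_inner_self_eq_norm_sq] at h
  have h2 : 0 ≤ ‖d - lam⁻¹ • e‖ ^ 2 := sq_nonneg _
  rw [norm_sub_sq_real, norm_smul, mul_pow, Real.norm_eq_abs, sq_abs, real_inner_smul_right,
    inv_pow] at h2
  have h3 : 0 ≤ lam⁻¹ * (inner ℝ d e - lam * (‖d‖ ^ 2 + inner ℝ d Y)) :=
    mul_nonneg (inv_nonneg.2 hlam.le) h
  rw [mul_sub, inv_mul_cancel_left₀ hlam.ne'] at h3
  have e2 : yosida T lam x' = d + Y := (sub_add_cancel _ _).symm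
  rw [e2, norm_add_sq_real]
  linarith

end Operators

/-! ### Recursive inequalities for real sequences -/

section Sequences

/-- For each fixed index, the recursion of Chung's lemma bounds the sequence by a multiple of its
scale `r`, with a constant that depends neither on the sequence nor on `r`. -/
theorem exists_le_mul_of_recursion {A B ρ : ℝ} (hA : 0 ≤ A) (hB : 0 ≤ B) (hρ : 0 ≤ ρ)
    {α : ℕ → ℝ} (hα₀ : ∀ j, 0 ≤ α j) (n : ℕ) :
    ∃ G : ℝ, 0 ≤ G ∧ ∀ (a : ℕ → ℝ) (r : ℝ), 0 ≤ r → (∀ j, 0 ≤ a j) → a 0 ≤ r →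
      (∀ j < n, a (j + 1) ≤ (1 - ρ * α j + A * α j ^ 2) * a j + B * α j ^ 2 * r) →
      a n ≤ G * r := by
  induction n with
  | zero => exact ⟨1, zero_le_one, fun a r _ _ h _ => by simpa using h⟩
  | succ n ih =>
    obtain ⟨G, hG, h⟩ := ih
    refine ⟨(1 + A * α n ^ 2) * G + B * α n ^ 2, by positivity, fun a r hr ha h0 hrec => ?_⟩
    have h1 := h a r hr ha h0 fun j hj => hrec j (hj.trans n.lt_succ_self)
    have h2 := hrec n n.lt_succ_self
    have h3 : (1 - ρ * α n + A * α n ^ 2) * a n ≤ (1 + A * α n ^ 2) * a n := by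
      have := mul_nonneg (mul_nonneg hρ (hα₀ n)) (ha n)
      linarith
    have h4 : (1 + A * α n ^ 2) * a n ≤ (1 + A * α n ^ 2) * (G * r) := by
      have := mul_nonneg hA (sq_nonneg (α n))
      gcongr
    linarith

/-- Chung's lemma for step lengths `θ / j`: a sequence with contraction factors
`1 - ρ θ / j + O(1 / j²)`, where `ρ θ > 2`, and perturbations `O(r / j²)` is `O(r / j)`. The constant
depends neither on the sequence nor on its scale `r`. -/
theorem exists_le_div_of_recursion {A B ρ θ : ℝ} (hA : 0 ≤ A) (hB : 0 ≤ B) (hρ : 0 ≤ ρ)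
    (hρθ : 2 < ρ * θ) {α : ℕ → ℝ} (hα₀ : ∀ j, 0 ≤ α j) (hα : ∀ j : ℕ, 1 ≤ j → α j = θ / j) :
    ∃ C : ℝ, 0 ≤ C ∧ ∀ (N : ℕ) (a : ℕ → ℝ) (r : ℝ), 1 ≤ N → 0 ≤ r → (∀ j, 0 ≤ a j) → a 0 ≤ r →
      (∀ j < N, a (j + 1) ≤ (1 - ρ * α j + A * α j ^ 2) * a j + B * α j ^ 2 * r) →
      a N ≤ C * r / N := by
  choose G hG0 hG using exists_le_mul_of_recursion hA hB hρ hα₀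
  -- From `j₀` on, the contraction factor is at most `1 - 2 / j`.
  set j₀ : ℕ := max 2 ⌈A * θ ^ 2 / (ρ * θ - 2)⌉₊ with hj₀
  have hj₀2 : 2 ≤ j₀ := le_max_left _ _
  set Q : ℝ := B * θ ^ 2 + j₀ * G j₀ with hQ
  have hBQ : B * θ ^ 2 ≤ Q := le_add_of_nonneg_right (mul_nonneg (Nat.cast_nonneg _) (hG0 _))
  have hQ0 : 0 ≤ Q := le_trans (by positivity) hBQ
  have hS0 : ∀ j ∈ Finset.range j₀, 0 ≤ (j : ℝ) * G j :=
    fun j _ => mul_nonneg (Nat.cast_nonneg _) (hG0 _)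
  refine ⟨Q + ∑ j ∈ Finset.range j₀, j * G j, add_nonneg hQ0 (Finset.sum_nonneg hS0),
    fun N a r hN hr ha h0 hrec => ?_⟩
  have hN0 : (0 : ℝ) < N := by exact_mod_cast hN
  rcases lt_or_ge N j₀ with hlt | hge
  · have h1 : (N : ℝ) * G N ≤ ∑ j ∈ Finset.range j₀, (j : ℝ) * G j :=
      Finset.single_le_sum (f := fun j : ℕ => (j : ℝ) * G j) hS0 (Finset.mem_range.2 hlt)
    rw [le_div_iff₀ hN0]
    have h2 := hG N a r hr ha h0 hrec
    calc a N * N ≤ G N * r * N := by gcongr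
      _ = N * G N * r := by ring
      _ ≤ _ := by
        gcongr
        linarith
  · have key : ∀ n, j₀ ≤ n → n ≤ N → a n ≤ Q * r / n := by
      intro n hn
      induction n, hn using Nat.le_induction with
      | base =>
        intro hle
        have hpos : (0 : ℝ) < j₀ := by exact_mod_cast (by omega : 0 < j₀)
        rw [le_div_iff₀ hpos]
        have h2 := hG j₀ a r hr ha h0 fun j hj => hrec j (hj.trans_le hle)
        calc a j₀ * j₀ ≤ G j₀ * r * j₀ := by gcongr
          _ = j₀ * G j₀ * r := by ring
          _ ≤ Q * r := by
            gcongr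
            rw [hQ]
            have : 0 ≤ B * θ ^ 2 := by positivity
            linarith
      | succ n hn ih =>
        intro hle
        have hn2 : (2 : ℝ) ≤ n := by exact_mod_cast hj₀2.trans hn
        have hn0 : (0 : ℝ) < n := by linarith
        have hAn : A * θ ^ 2 ≤ (ρ * θ - 2) * n := by
          have h1 : A * θ ^ 2 / (ρ * θ - 2) ≤ n :=
            (Nat.le_ceil _).trans (by exact_mod_cast (le_max_right _ _).trans hn)
          rwa [div_le_iff₀' (by linarith)] at h1
        have h1 := hrec n (by omega)
        have han := ih (by omega)
        rw [hα n (by omega)] at h1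
        have hcoef : 1 - ρ * (θ / n) + A * (θ / n) ^ 2 ≤ 1 - 2 / n := by
          have : A * (θ / n) ^ 2 ≤ (ρ * θ - 2) / n := by
            rw [div_pow, ← mul_div_assoc, div_le_div_iff₀ (by positivity) hn0]
            nlinarith
          have e : ρ * (θ / n) = (ρ * θ - 2) / n + 2 / n := by ring
          linarith
        have h2n : 0 ≤ 1 - 2 / (n : ℝ) := by
          rw [sub_nonneg, div_le_one hn0]
          exact hn2
        have h2 : a (n + 1) ≤ (1 - 2 / n) * (Q * r / n) + Q * r / n ^ 2 := by
          refine h1.trans (add_le_add ?_ ?_)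
          · exact (mul_le_mul_of_nonneg_right hcoef (ha n)).trans
              (mul_le_mul_of_nonneg_left han h2n)
          · calc B * (θ / n) ^ 2 * r = B * θ ^ 2 * r / n ^ 2 := by ring
              _ ≤ Q * r / n ^ 2 := by gcongr
        refine h2.trans ?_
        have e : (1 - 2 / n) * (Q * r / n) + Q * r / n ^ 2 = Q * r * ((n - 1) / n ^ 2) := by
          field_simp
          ring
        have e' : Q * r / ((n + 1 : ℕ) : ℝ) = Q * r * (1 / (n + 1)) := by
          push_cast
          ring
        rw [e, e']
        refine mul_le_mul_of_nonneg_left ?_ (mul_nonneg hQ0 hr)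
        rw [div_le_div_iff₀ (by positivity) (by positivity)]
        nlinarith
    refine (key N hge le_rfl).trans ?_
    gcongr
    exact le_add_of_nonneg_right (Finset.sum_nonneg hS0)

/-- The deterministic case of the Robbins–Siegmund lemma. -/
theorem exists_bound_of_le_one_add_mul_sub {u y τ : ℕ → ℝ} (hu : ∀ k, 0 ≤ u k)
    (hy : ∀ k, 0 ≤ y k) (hτ : ∀ k, 0 ≤ τ k) (hτs : Summable τ)
    (h : ∀ k, u (k + 1) ≤ (1 + τ k) * u k - y k) :
    ∃ H : ℝ, (∀ k, u k ≤ H) ∧ ∀ K, ∑ k ∈ Finset.range K, y k ≤ H := by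
  set M := u 0 * Real.exp (∑' k, τ k)
  have hM : ∀ k, u k ≤ M := by
    have h1 : ∀ k, u k ≤ u 0 * Real.exp (∑ i ∈ Finset.range k, τ i) := by
      intro k
      induction k with
      | zero => simp
      | succ k ih =>
        rw [Finset.sum_range_succ, Real.exp_add]
        calc u (k + 1) ≤ (1 + τ k) * u k := (h k).trans (sub_le_self _ (hy k))
          _ ≤ Real.exp (τ k) * (u 0 * Real.exp (∑ i ∈ Finset.range k, τ i)) := by
            refine mul_le_mul ?_ ih (hu k) (Real.exp_pos _).le
            linarith [Real.add_one_le_exp (τ k)]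
          _ = _ := by ring
    exact fun k => (h1 k).trans (mul_le_mul_of_nonneg_left
      (Real.exp_le_exp.2 (hτs.sum_le_tsum _ fun i _ => hτ i)) (hu 0))
  have hM0 : 0 ≤ M := (hu 0).trans (hM 0)
  have hsum : ∀ K, u K + ∑ k ∈ Finset.range K, y k ≤ u 0 + M * ∑ k ∈ Finset.range K, τ k := by
    intro K
    induction K with
    | zero => simp
    | succ K ih =>
      rw [Finset.sum_range_succ, Finset.sum_range_succ]
      have h1 := h K
      have h2 := mul_le_mul_of_nonneg_left (hM K) (hτ K)
      linarith
  refine ⟨M + M * ∑' k, τ k, fun k => ?_, fun K => ?_⟩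
  · have : 0 ≤ M * ∑' k, τ k := mul_nonneg hM0 (tsum_nonneg hτ)
    linarith [hM k]
  · have h1 := mul_le_mul_of_nonneg_left (hτs.sum_le_tsum (Finset.range K) fun i _ => hτ i) hM0
    linarith [hsum K, hu K, hM 0]

/-- A sequence with bounded partial sums that is decreasing up to errors `δ k` with
`∑ (k + 1) δ k < ∞` is `O(1 / k)`. -/
theorem exists_le_div_of_sum_le {y δ : ℕ → ℝ} {H : ℝ} (hδ : ∀ k, 0 ≤ δ k)
    (hδs : Summable fun k : ℕ => ((k : ℝ) + 1) * δ k) (h : ∀ k, y (k + 1) ≤ y k + δ k)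
    (hH : ∀ K, ∑ k ∈ Finset.range K, y k ≤ H) :
    ∃ C : ℝ, ∀ k : ℕ, y k ≤ C / ((k : ℝ) + 1) := by
  have h1 : ∀ k : ℕ, ((k : ℝ) + 1) * y k ≤ ∑ i ∈ Finset.range (k + 1), y i +
      ∑ i ∈ Finset.range k, ((i : ℝ) + 1) * δ i := by
    intro k
    induction k with
    | zero => simp
    | succ k ih =>
      rw [Finset.sum_range_succ, Finset.sum_range_succ (fun i : ℕ => ((i : ℝ) + 1) * δ i) k]
      have := mul_le_mul_of_nonneg_left (h k) (by positivity : (0 : ℝ) ≤ k + 1)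
      push_cast
      linarith
  refine ⟨H + ∑' k : ℕ, ((k : ℝ) + 1) * δ k, fun k => ?_⟩
  rw [le_div_iff₀' (by positivity)]
  exact (h1 k).trans (add_le_add (hH _)
    (hδs.sum_le_tsum _ fun i _ => mul_nonneg (by positivity) (hδ i)))

theorem summable_add_one_rpow_neg {a : ℝ} (ha : 1 < a) :
    Summable fun k : ℕ => ((k : ℝ) + 1) ^ (-a) := by
  have := (summable_nat_add_iff 1).2 (Real.summable_nat_rpow.2 (neg_lt_neg ha))
  simpa using this

theorem one_le_sampleSize (a : ℝ) (k : ℕ) : 1 ≤ sampleSize a k :=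
  Nat.ceil_pos.2 (by positivity)

theorem inv_sampleSize_le (a : ℝ) (k : ℕ) :
    (sampleSize a k : ℝ)⁻¹ ≤ (((k : ℝ) + 1) ^ (-a)) ^ 2 := by
  have h : (((k : ℝ) + 1) ^ (-a)) ^ 2 = (((k : ℝ) + 1) ^ (2 * a))⁻¹ := by
    rw [← Real.rpow_natCast, ← Real.rpow_mul (by positivity), ← Real.rpow_neg (by positivity)]
    congr 1
    push_cast
    ring
  rw [h]
  exact inv_anti₀ (by positivity) (Nat.le_ceil _)

/-- A rate `C / (k + 1)` makes `⌈C / ε⌉ + 1` outer steps sufficient for accuracy `ε`, and these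
cost `O(ε ^ (-(2 a + 1)))` samples. -/
theorem exists_sum_sampleSize_le {a C : ℝ} (ha : 0 ≤ a) (hC : 0 ≤ C) :
    ∃ C' : ℝ, ∀ ε : ℝ, 0 < ε → ε ≤ 1 → ∃ K : ℕ, C / (((K + 1 : ℕ) : ℝ) + 1) ≤ ε ∧
      ∑ k ∈ Finset.range (K + 1), (sampleSize a k : ℝ) ≤ C' / ε ^ (2 * a + 1) := by
  refine ⟨2 * (C + 2) ^ (2 * a + 1), fun ε hε hε1 => ⟨⌈C / ε⌉₊, ?_, ?_⟩⟩
  · rw [div_le_iff₀ (by positivity)]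
    have h1 : C ≤ ⌈C / ε⌉₊ * ε := (div_le_iff₀ hε).1 (Nat.le_ceil _)
    push_cast
    nlinarith
  · set K := ⌈C / ε⌉₊
    have hK : (K : ℝ) + 1 ≤ (C + 2) / ε := by
      have h1 : (K : ℝ) < C / ε + 1 := Nat.ceil_lt_add_one (by positivity)
      have h2 : 1 ≤ 1 / ε := (one_le_div hε).2 hε1
      calc (K : ℝ) + 1 ≤ C / ε + 2 * (1 / ε) := by linarith
        _ = (C + 2) / ε := by ring
    have hterm : ∀ k ∈ Finset.range (K + 1),
        (sampleSize a k : ℝ) ≤ 2 * ((K : ℝ) + 1) ^ (2 * a) := by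
      intro k hk
      have hkK : (k : ℝ) ≤ K := by exact_mod_cast Nat.lt_succ_iff.1 (Finset.mem_range.1 hk)
      have h1 : (sampleSize a k : ℝ) < ((k : ℝ) + 1) ^ (2 * a) + 1 :=
        Nat.ceil_lt_add_one (by positivity)
      have h2 : ((k : ℝ) + 1) ^ (2 * a) ≤ ((K : ℝ) + 1) ^ (2 * a) := by gcongr
      have h3 : 1 ≤ ((K : ℝ) + 1) ^ (2 * a) := Real.one_le_rpow (by simp) (by positivity)
      linarith
    calc ∑ k ∈ Finset.range (K + 1), (sampleSize a k : ℝ)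
        ≤ ∑ k ∈ Finset.range (K + 1), 2 * ((K : ℝ) + 1) ^ (2 * a) := Finset.sum_le_sum hterm
      _ = 2 * ((K : ℝ) + 1) ^ (2 * a + 1) := by
        rw [Finset.sum_const, Finset.card_range, nsmul_eq_mul, Real.rpow_add_one (by positivity)]
        push_cast
        ring
      _ ≤ 2 * ((C + 2) / ε) ^ (2 * a + 1) := by gcongr
      _ = 2 * (C + 2) ^ (2 * a + 1) / ε ^ (2 * a + 1) := by
        rw [Real.div_rpow (by positivity) hε.le]
        ring

end Sequences

/-! ### Measurability and independence of the iterates -/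

section Measurability

variable {E S Ω : Type*} [NormedAddCommGroup E] [InnerProductSpace ℝ E] [FiniteDimensional ℝ E]
  [MeasurableSpace E] [BorelSpace E] [MeasurableSpace S]
  {v : E → S → E} {lam : ℝ} {α : ℕ → ℝ} {N : ℕ → ℕ} {x₀ : E}

theorem measurable_saIter [MeasurableSpace Ω] (hv : Measurable (Function.uncurry v)) {X : Ω → E}
    (hX : Measurable X) {s : ℕ → Ω → S} (j : ℕ) (hs : ∀ i < j, Measurable (s i)) :
    Measurable fun ω => saIter v lam α (X ω) (fun i => s i ω) j := by
  induction j with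
  | zero => exact hX
  | succ j ih =>
    have h := ih fun i hi => hs i (hi.trans j.lt_succ_self)
    have hv' := hv.comp (h.prodMk (hs j j.lt_succ_self))
    exact h.sub ((hv'.add ((h.sub hX).const_smul _)).const_smul _)

theorem measurable_iterate [MeasurableSpace Ω] (hv : Measurable (Function.uncurry v))
    {ξ : ℕ → ℕ → Ω → S} (k : ℕ) (hξ : ∀ i < k, ∀ j, Measurable (ξ i j)) :
    Measurable fun ω => iterate v lam α N x₀ (fun k j => ξ k j ω) k := by
  induction k with
  | zero => exact measurable_const
  | succ k ih =>
    exact measurable_saIter hv (ih fun i hi => hξ i (hi.trans k.lt_succ_self)) _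
      fun j _ => hξ k k.lt_succ_self j

theorem measurable_innerIterate [MeasurableSpace Ω] (hv : Measurable (Function.uncurry v))
    {ξ : ℕ → ℕ → Ω → S} (k j : ℕ) (hξ : ∀ i < k, ∀ j, Measurable (ξ i j))
    (hξ' : ∀ i < j, Measurable (ξ k i)) :
    Measurable fun ω => innerIterate v lam α N x₀ (fun k j => ξ k j ω) k j :=
  measurable_saIter hv (measurable_iterate hv k hξ) j hξ'

theorem indepFun_innerIterate [MeasurableSpace Ω] {P : Measure Ω}
    (hv : Measurable (Function.uncurry v)) {ξ : ℕ → ℕ → Ω → S} (hξ : ∀ k j, Measurable (ξ k j))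
    (hindep : iIndepFun (fun p : ℕ × ℕ => ξ p.1 p.2) P) (k j : ℕ) :
    IndepFun (fun ω => (iterate v lam α N x₀ (fun k j => ξ k j ω) k,
      innerIterate v lam α N x₀ (fun k j => ξ k j ω) k j)) (ξ k j) P := by
  set m : ℕ × ℕ → MeasurableSpace Ω := fun p => MeasurableSpace.comap (ξ p.1 p.2) inferInstance
  -- The pairs indexing the samples drawn before `ξ k j`.
  set past : Set (ℕ × ℕ) := {p | p.1 < k ∨ p.1 = k ∧ p.2 < j} with hpast
  have hdisj : Disjoint past {(k, j)} := by
    rw [Set.disjoint_singleton_right]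
    simp [hpast]
  have h := indep_iSup_of_disjoint (m := m) (fun p => (hξ p.1 p.2).comap_le) hindep hdisj
  have hmeas : ∀ p ∈ past, Measurable[⨆ q ∈ past, m q] (ξ p.1 p.2) := fun p hp =>
    Measurable.of_comap_le (le_iSup₂_of_le (f := fun q (_ : q ∈ past) => m q) p hp le_rfl)
  have h1 : ∀ i < k, ∀ l, Measurable[⨆ q ∈ past, m q] (ξ i l) :=
    fun i hi l => hmeas (i, l) (Or.inl hi)
  have h2 : ∀ i < j, Measurable[⨆ q ∈ past, m q] (ξ k i) :=
    fun i hi => hmeas (k, i) (Or.inr ⟨rfl, hi⟩)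
  refine indep_of_indep_of_le_left (indep_of_indep_of_le_right h ?_) ?_
  · exact le_iSup₂_of_le (f := fun q (_ : q ∈ ({(k, j)} : Set (ℕ × ℕ))) => m q) (k, j) rfl le_rfl
  · exact Measurable.comap_le (Measurable.prodMk
      (@measurable_iterate E S Ω _ _ _ _ _ _ v lam α N x₀ (⨆ q ∈ past, m q) hv ξ k h1)
      (@measurable_innerIterate E S Ω _ _ _ _ _ _ v lam α N x₀ (⨆ q ∈ past, m q) hv ξ k j h1 h2))

/-- A sample independent of `W` may be integrated out with `W` frozen. -/
theorem identDistrib_prodMk_of_indepFun [MeasurableSpace Ω] {β : Type*} [MeasurableSpace β]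
    {μ : Measure S} [IsProbabilityMeasure μ] {P : Measure Ω} [IsProbabilityMeasure P]
    {W : Ω → β} {ξ : Ω → S} (hW : Measurable W) (hξ : Measurable ξ) (hlaw : P.map ξ = μ)
    (hind : IndepFun W ξ P) :
    IdentDistrib (fun ω => (W ω, ξ ω)) (fun q : Ω × S => (W q.1, q.2)) P (P.prod μ) where
  aemeasurable_fst := (hW.prodMk hξ).aemeasurable
  aemeasurable_snd := ((hW.comp measurable_fst).prodMk measurable_snd).aemeasurable
  map_eq := by
    rw [hind.map_prod_eq_prod_map_map hW.aemeasurable hξ.aemeasurable, hlaw]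
    conv_lhs => rw [← Measure.map_id (μ := μ)]
    exact Measure.map_prod_map _ _ hW measurable_id

end Measurability

/-! ### The inner stochastic approximation scheme -/

section InnerScheme

theorem _root_.MeasureTheory.MemLp.integrable_norm_sq {Ω F : Type*} [MeasurableSpace Ω]
    [NormedAddCommGroup F] {P : Measure Ω} {X : Ω → F} (hX : MemLp X 2 P) :
    Integrable (fun ω => ‖X ω‖ ^ 2) P :=
  (memLp_two_iff_integrable_sq_norm hX.1).1 hX


theorem norm_add_add_sq_le {F : Type*} [SeminormedAddCommGroup F] (x y z : F) :
    ‖x + y + z‖ ^ 2 ≤ 3 * ‖x‖ ^ 2 + 3 * ‖y‖ ^ 2 + 3 * ‖z‖ ^ 2 := by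
  have h : ‖x + y + z‖ ≤ ‖x‖ + ‖y‖ + ‖z‖ := norm_add₃_le
  nlinarith [norm_nonneg (x + y + z), sq_nonneg (‖x‖ - ‖y‖), sq_nonneg (‖x‖ - ‖z‖),
    sq_nonneg (‖y‖ - ‖z‖)]

variable {E S Ω : Type*} [NormedAddCommGroup E] [InnerProductSpace ℝ E]

theorem abs_inner_le_sq_add_sq (x y : E) : |inner ℝ x y| ≤ ‖x‖ ^ 2 + ‖y‖ ^ 2 := by
  have := abs_real_inner_le_norm x y
  nlinarith [sq_nonneg (‖x‖ - ‖y‖), sq_nonneg ‖x‖, sq_nonneg ‖y‖]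

variable [FiniteDimensional ℝ E] [MeasurableSpace Ω] {P : Measure Ω} [IsProbabilityMeasure P]
  {lam : ℝ}

theorem memLp_resolvent {T : E → Set E} (hT : IsMaximalMonotone T) (hlam : 0 < lam) {x₁ : E}
    (hx₁ : 0 ∈ T x₁) {X : Ω → E} (hX : MemLp X 2 P) :
    MemLp (fun ω => resolvent T lam (X ω)) 2 P := by
  have h := (hX.sub (memLp_const x₁)).mono (g := X - fun _ => x₁)
    (f := fun ω => resolvent T lam (X ω) - x₁)
    (((continuous_resolvent hT hlam).comp_aestronglyMeasurable hX.1).sub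
      aestronglyMeasurable_const) (Filter.Eventually.of_forall fun ω => by
      refine le_of_sq_le_sq ?_ (norm_nonneg _)
      have := norm_resolvent_sub_sq_add_le_of_zero_mem hT hlam hx₁ (X ω)
      simp only [Pi.sub_apply]
      nlinarith [sq_nonneg (lam * ‖yosida T lam (X ω)‖)])
  have e : (fun ω => resolvent T lam (X ω)) =
      (fun ω => resolvent T lam (X ω) - x₁) + fun _ => x₁ := by
    ext1 ω
    simp
  rw [e]
  exact h.add (memLp_const x₁)

theorem memLp_yosida {T : E → Set E} (hT : IsMaximalMonotone T) (hlam : 0 < lam) {x₁ : E}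
    (hx₁ : 0 ∈ T x₁) {X : Ω → E} (hX : MemLp X 2 P) :
    MemLp (fun ω => yosida T lam (X ω)) 2 P :=
  (hX.sub (memLp_resolvent hT hlam hx₁ hX)).const_smul lam⁻¹

variable [MeasurableSpace E] [BorelSpace E] [MeasurableSpace S] {μ : Measure S}
  [IsProbabilityMeasure μ] {Φ : E → S → Set E} {D : Set E} {v : E → S → E} {M₁ M₂ : ℝ}

/-- The oracle answer at a random query point that is independent of the sample is square
integrable, with the second-moment bound of the oracle. -/
theorem IsOracle.memLp_comp (hv : IsOracle μ Φ D v M₁ M₂) {Z : Ω → E} {ξ : Ω → S}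
    (hZ : Measurable Z) (hξ : Measurable ξ) (hlaw : P.map ξ = μ) (hind : IndepFun Z ξ P)
    (hD : ∀ᵐ ω ∂P, Z ω ∈ D) (hZ2 : MemLp Z 2 P) :
    MemLp (fun ω => v (Z ω) (ξ ω)) 2 P ∧
      ∫ ω, ‖v (Z ω) (ξ ω)‖ ^ 2 ∂P ≤ M₁ ^ 2 * ∫ ω, ‖Z ω‖ ^ 2 ∂P + M₂ ^ 2 := by
  have hg : Measurable fun p : E × S => ‖Function.uncurry v p‖ ^ 2 := hv.measurable.norm.pow_const 2
  have hid := (identDistrib_prodMk_of_indepFun hZ hξ hlaw hind).comp hg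
  have hbound : Integrable (fun ω => M₁ ^ 2 * ‖Z ω‖ ^ 2 + M₂ ^ 2) P :=
    (hZ2.integrable_norm_sq.const_mul _).add (integrable_const _)
  have hmeas : AEStronglyMeasurable (fun q : Ω × S => ‖v (Z q.1) q.2‖ ^ 2) (P.prod μ) :=
    (hg.comp ((hZ.comp measurable_fst).prodMk measurable_snd)).aestronglyMeasurable
  have hint : Integrable (fun q : Ω × S => ‖v (Z q.1) q.2‖ ^ 2) (P.prod μ) := by
    refine (integrable_prod_iff hmeas).2 ⟨?_, hbound.mono' hmeas.norm.integral_prod_right' ?_⟩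
    · filter_upwards [hD] with ω hω
      exact (hv.memLp _ hω).integrable_norm_sq
    · filter_upwards [hD] with ω hω
      simp only [norm_pow, norm_norm]
      rw [Real.norm_of_nonneg (integral_nonneg fun _ => by positivity)]
      exact hv.second_moment _ hω
  have hV : Measurable fun ω => v (Z ω) (ξ ω) := hv.measurable.comp (hZ.prodMk hξ)
  refine ⟨(memLp_two_iff_integrable_sq_norm hV.aestronglyMeasurable).2 (hid.integrable_iff.2 hint),
    ?_⟩
  calc ∫ ω, ‖v (Z ω) (ξ ω)‖ ^ 2 ∂P = ∫ q, ‖v (Z q.1) q.2‖ ^ 2 ∂(P.prod μ) := hid.integral_eq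
    _ = ∫ ω, ∫ s, ‖v (Z ω) s‖ ^ 2 ∂μ ∂P := integral_prod _ hint
    _ ≤ ∫ ω, (M₁ ^ 2 * ‖Z ω‖ ^ 2 + M₂ ^ 2) ∂P := by
      refine integral_mono_ae hint.integral_prod_left hbound ?_
      filter_upwards [hD] with ω hω
      exact hv.second_moment _ hω
    _ = M₁ ^ 2 * ∫ ω, ‖Z ω‖ ^ 2 ∂P + M₂ ^ 2 := by
      rw [integral_add (hZ2.integrable_norm_sq.const_mul _) (integrable_const _),
        integral_const_mul]
      simp

/-- The mean field of the oracle is monotone, so on average it pushes the query point `Z` towards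
the resolvent point of `X`. -/
theorem integral_inner_sub_resolvent_nonneg (hT : IsMaximalMonotone (expectedMap μ Φ))
    (hlam : 0 < lam) {x₁ : E} (hx₁ : 0 ∈ expectedMap μ Φ x₁) (hv : IsOracle μ Φ D v M₁ M₂)
    {X Z : Ω → E} {ξ : Ω → S} (hX : Measurable X) (hZ : Measurable Z) (hξ : Measurable ξ)
    (hlaw : P.map ξ = μ) (hind : IndepFun (fun ω => (X ω, Z ω)) ξ P) (hD : ∀ᵐ ω ∂P, Z ω ∈ D)
    (hX2 : MemLp X 2 P) (hZ2 : MemLp Z 2 P) :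
    Integrable (fun ω => inner ℝ (Z ω - resolvent (expectedMap μ Φ) lam (X ω))
        (v (Z ω) (ξ ω) - yosida (expectedMap μ Φ) lam (X ω))) P ∧
      0 ≤ ∫ ω, inner ℝ (Z ω - resolvent (expectedMap μ Φ) lam (X ω))
        (v (Z ω) (ξ ω) - yosida (expectedMap μ Φ) lam (X ω)) ∂P := by
  set J := resolvent (expectedMap μ Φ) lam
  set Y := yosida (expectedMap μ Φ) lam
  have hJ : Measurable J := (continuous_resolvent hT hlam).measurable
  have hY : Measurable Y := (continuous_yosida hT hlam).measurable
  have hg : Measurable fun p : (E × E) × S =>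
      (inner ℝ (p.1.2 - J p.1.1) (v p.1.2 p.2 - Y p.1.1) : ℝ) := by
    have h1 : Measurable fun p : (E × E) × S => v p.1.2 p.2 :=
      hv.measurable.comp ((measurable_snd.comp measurable_fst).prodMk measurable_snd)
    have h2 : Measurable fun p : (E × E) × S => p.1.1 := measurable_fst.comp measurable_fst
    have h3 : Measurable fun p : (E × E) × S => p.1.2 := measurable_snd.comp measurable_fst
    exact (h3.sub (hJ.comp h2)).inner (h1.sub (hY.comp h2))
  have hid := (identDistrib_prodMk_of_indepFun (hX.prodMk hZ) hξ hlaw hind).comp hg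
  have hV := (hv.memLp_comp hZ hξ hlaw (hind.comp measurable_snd measurable_id) hD hZ2).1
  have hint : Integrable (fun ω => (inner ℝ (Z ω - J (X ω)) (v (Z ω) (ξ ω) - Y (X ω)) : ℝ)) P := by
    refine ((hZ2.sub (memLp_resolvent hT hlam hx₁ hX2)).integrable_norm_sq.add
      (hV.sub (memLp_yosida hT hlam hx₁ hX2)).integrable_norm_sq).mono'
      (hg.comp ((hX.prodMk hZ).prodMk hξ)).aestronglyMeasurable
      (Filter.Eventually.of_forall fun ω => abs_inner_le_sq_add_sq _ _)
  refine ⟨hint, ?_⟩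
  have hint' := hid.integrable_iff.1 hint
  calc (0 : ℝ) ≤ ∫ ω, ∫ s, inner ℝ (Z ω - J (X ω)) (v (Z ω) s - Y (X ω)) ∂μ ∂P := by
        refine integral_nonneg_of_ae ?_
        filter_upwards [hD] with ω hω
        have hi : Integrable (v (Z ω)) μ := (hv.memLp _ hω).integrable (by norm_num)
        have hi' : Integrable (fun s => v (Z ω) s - Y (X ω)) μ := hi.sub (integrable_const _)
        rw [integral_inner hi', integral_sub hi (integrable_const _)]
        simp only [integral_const, probReal_univ, one_smul]
        rw [real_inner_comm]
        exact hT.1 _ _ _ _ (hv.mean_mem _ hω) (yosida_mem hT hlam (X ω))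
    _ = ∫ q, inner ℝ (Z q.1 - J (X q.1)) (v (Z q.1) q.2 - Y (X q.1)) ∂(P.prod μ) :=
      (integral_prod _ hint').symm
    _ = _ := hid.integral_eq.symm

/-- One step of stochastic approximation for the resolvent problem at `X`: the mean squared distance
to the solution contracts by `1 - 2 α / lam` up to terms of order `α²`. -/
theorem integral_saStep_le (hT : IsMaximalMonotone (expectedMap μ Φ))
    (hlam : 0 < lam) {x₁ : E} (hx₁ : 0 ∈ expectedMap μ Φ x₁) (hv : IsOracle μ Φ D v M₁ M₂)
    {α : ℝ} (hα : 0 ≤ α)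
    {X Z : Ω → E} {ξ : Ω → S} (hX : Measurable X) (hZ : Measurable Z) (hξ : Measurable ξ)
    (hlaw : P.map ξ = μ) (hind : IndepFun (fun ω => (X ω, Z ω)) ξ P) (hD : ∀ᵐ ω ∂P, Z ω ∈ D)
    (hX2 : MemLp X 2 P) (hZ2 : MemLp Z 2 P) :
    MemLp (fun ω => Z ω - α • (v (Z ω) (ξ ω) + lam⁻¹ • (Z ω - X ω))) 2 P ∧
      ∫ ω, ‖Z ω - α • (v (Z ω) (ξ ω) + lam⁻¹ • (Z ω - X ω)) -
          resolvent (expectedMap μ Φ) lam (X ω)‖ ^ 2 ∂P ≤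
        (1 - 2 * lam⁻¹ * α + (9 * M₁ ^ 2 + 3 * lam⁻¹ ^ 2) * α ^ 2) *
          ∫ ω, ‖Z ω - resolvent (expectedMap μ Φ) lam (X ω)‖ ^ 2 ∂P +
        (9 * M₁ ^ 2 * (1 + ‖x₁‖ ^ 2) + 3 * M₂ ^ 2 + 3 * lam⁻¹ ^ 2) * α ^ 2 *
          (∫ ω, ‖X ω - x₁‖ ^ 2 ∂P + 1) := by
  obtain ⟨hinner, hinner0⟩ :=
    integral_inner_sub_resolvent_nonneg hT hlam hx₁ hv hX hZ hξ hlaw hind hD hX2 hZ2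
  obtain ⟨hV, hVle⟩ := hv.memLp_comp hZ hξ hlaw (hind.comp measurable_snd measurable_id) hD hZ2
  have hJ2 := memLp_resolvent hT hlam hx₁ hX2
  have hY2 := memLp_yosida hT hlam hx₁ hX2
  have hfirm := fun ω => norm_resolvent_sub_sq_add_le_of_zero_mem hT hlam hx₁ (X ω)
  have hsY := fun ω => smul_yosida (T := expectedMap μ Φ) hlam (X ω)
  set J := resolvent (expectedMap μ Φ) lam
  set Y := yosida (expectedMap μ Φ) lam
  have hZ' : MemLp (fun ω => Z ω - α • (v (Z ω) (ξ ω) + lam⁻¹ • (Z ω - X ω))) 2 P :=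
    hZ2.sub ((hV.add ((hZ2.sub hX2).const_smul lam⁻¹)).const_smul α)
  refine ⟨hZ', ?_⟩
  have he2 := hZ2.sub hJ2
  have hR2 := hX2.sub (memLp_const x₁)
  have hpt : ∀ ω, ‖Z ω - α • (v (Z ω) (ξ ω) + lam⁻¹ • (Z ω - X ω)) - J (X ω)‖ ^ 2 ≤
      (1 - 2 * lam⁻¹ * α + 3 * lam⁻¹ ^ 2 * α ^ 2) * ‖Z ω - J (X ω)‖ ^ 2
        - 2 * α * inner ℝ (Z ω - J (X ω)) (v (Z ω) (ξ ω) - Y (X ω))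
        + 3 * α ^ 2 * ‖v (Z ω) (ξ ω)‖ ^ 2 + 3 * lam⁻¹ ^ 2 * α ^ 2 * ‖X ω - x₁‖ ^ 2 := by
    intro ω
    have e1 : Z ω - α • (v (Z ω) (ξ ω) + lam⁻¹ • (Z ω - X ω)) - J (X ω) =
        (Z ω - J (X ω)) - α • ((v (Z ω) (ξ ω) - Y (X ω)) + lam⁻¹ • (Z ω - J (X ω))) := by
      have : lam⁻¹ • (Z ω - X ω) = lam⁻¹ • (Z ω - J (X ω)) - Y (X ω) := by
        rw [← sub_sub_sub_cancel_right _ _ (J (X ω)), ← hsY, smul_sub, inv_smul_smul₀ hlam.ne']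
      rw [this]
      module
    have h1 := norm_add_add_sq_le (v (Z ω) (ξ ω)) (-Y (X ω)) (lam⁻¹ • (Z ω - J (X ω)))
    rw [← sub_eq_add_neg, norm_neg, norm_smul, mul_pow, Real.norm_eq_abs, sq_abs] at h1
    have h2 : ‖Y (X ω)‖ ^ 2 ≤ lam⁻¹ ^ 2 * ‖X ω - x₁‖ ^ 2 := by
      rw [inv_pow, inv_mul_eq_div, le_div_iff₀' (by positivity)]
      linarith [hfirm ω, sq_nonneg ‖J (X ω) - x₁‖]
    rw [e1, norm_sub_sq_real, norm_smul, mul_pow, Real.norm_eq_abs, sq_abs, real_inner_smul_right,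
      inner_add_right, real_inner_smul_right, real_inner_self_eq_norm_sq]
    have h3 := mul_le_mul_of_nonneg_left h1 (sq_nonneg α)
    have h4 := mul_le_mul_of_nonneg_left h2 (by positivity : 0 ≤ 3 * α ^ 2)
    linarith
  -- The oracle bound is in terms of `‖Z‖ = ‖(Z - J X) + (J X - x₁) + x₁‖`.
  have hZle : ∫ ω, ‖Z ω‖ ^ 2 ∂P ≤ 3 * ∫ ω, ‖Z ω - J (X ω)‖ ^ 2 ∂P +
      3 * ∫ ω, ‖X ω - x₁‖ ^ 2 ∂P + 3 * ‖x₁‖ ^ 2 := by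
    have h1 : ∫ ω, ‖Z ω‖ ^ 2 ∂P ≤ ∫ ω, (3 * ‖Z ω - J (X ω)‖ ^ 2 + 3 * ‖X ω - x₁‖ ^ 2 +
        3 * ‖x₁‖ ^ 2) ∂P := by
      refine integral_mono hZ2.integrable_norm_sq
        (((he2.integrable_norm_sq.const_mul 3).add (hR2.integrable_norm_sq.const_mul 3)).add
          (integrable_const _)) fun ω => ?_
      have h1 := norm_add_add_sq_le (Z ω - J (X ω)) (J (X ω) - x₁) x₁
      rw [sub_add_sub_cancel, sub_add_cancel] at h1
      have h2 := hfirm ω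
      have h3 : 0 ≤ lam ^ 2 * ‖Y (X ω)‖ ^ 2 := by positivity
      simp only
      linarith
    refine h1.trans_eq ?_
    rw [integral_add, integral_add, integral_const_mul, integral_const_mul]
    · simp
    exacts [he2.integrable_norm_sq.const_mul 3, hR2.integrable_norm_sq.const_mul 3,
      (he2.integrable_norm_sq.const_mul 3).add (hR2.integrable_norm_sq.const_mul 3),
      integrable_const _]
  have i1 := he2.integrable_norm_sq.const_mul (1 - 2 * lam⁻¹ * α + 3 * lam⁻¹ ^ 2 * α ^ 2)
  have i2 := hinner.const_mul (2 * α)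
  have i3 := hV.integrable_norm_sq.const_mul (3 * α ^ 2)
  have i4 := hR2.integrable_norm_sq.const_mul (3 * lam⁻¹ ^ 2 * α ^ 2)
  have hint := integral_mono (hZ'.sub hJ2).integrable_norm_sq (((i1.sub i2).add i3).add i4) hpt
  have hsplit := hint.trans_eq (show _ = (1 - 2 * lam⁻¹ * α + 3 * lam⁻¹ ^ 2 * α ^ 2) *
        ∫ ω, ‖Z ω - J (X ω)‖ ^ 2 ∂P
      - 2 * α * ∫ ω, inner ℝ (Z ω - J (X ω)) (v (Z ω) (ξ ω) - Y (X ω)) ∂P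
      + 3 * α ^ 2 * ∫ ω, ‖v (Z ω) (ξ ω)‖ ^ 2 ∂P
      + 3 * lam⁻¹ ^ 2 * α ^ 2 * ∫ ω, ‖X ω - x₁‖ ^ 2 ∂P by
    rw [← integral_const_mul, ← integral_const_mul, ← integral_const_mul, ← integral_const_mul,
      ← integral_sub, ← integral_add, ← integral_add]
    exacts [rfl, (i1.sub i2).add i3, i4, i1.sub i2, i3, i1, i2])
  simp only [Pi.sub_apply] at hsplit
  have hR0 : 0 ≤ ∫ ω, ‖X ω - x₁‖ ^ 2 ∂P := integral_nonneg fun _ => by positivity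
  have h1 := mul_le_mul_of_nonneg_left hVle (by positivity : 0 ≤ 3 * α ^ 2)
  have h2 := mul_le_mul_of_nonneg_left hZle (by positivity : 0 ≤ 3 * α ^ 2 * M₁ ^ 2)
  have h3 := mul_nonneg (by positivity : 0 ≤ 2 * α) hinner0
  have h4 : 0 ≤ (9 * M₁ ^ 2 * ‖x₁‖ ^ 2 + 3 * M₂ ^ 2) * α ^ 2 * ∫ ω, ‖X ω - x₁‖ ^ 2 ∂P := by
    positivity
  have h5 : 0 ≤ (9 * M₁ ^ 2 + 3 * lam⁻¹ ^ 2) * α ^ 2 := by positivity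
  linarith

end InnerScheme

/-! ### The outer scheme -/

section OuterScheme

variable {E Ω : Type*} [NormedAddCommGroup E] [InnerProductSpace ℝ E] [FiniteDimensional ℝ E]
  [MeasurableSpace Ω] {P : Measure Ω} [IsProbabilityMeasure P] {lam : ℝ}

/-- An inexact proximal step with mean squared error at most `C τ² (E ‖X - x₁‖² + 1)` is
quasi-Fejér monotone: Young's inequality with weight `τ` splits off the error. -/
theorem integral_norm_sub_sq_le_of_inexact_step {T : E → Set E} (hT : IsMaximalMonotone T)
    (hlam : 0 < lam) {x₁ : E} (hx₁ : 0 ∈ T x₁) {X X' : Ω → E} (hX : MemLp X 2 P)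
    (hX' : MemLp X' 2 P) {C τ : ℝ} (hC : 0 ≤ C) (hτ : 0 < τ) (hτ1 : τ ≤ 1)
    (herr : ∫ ω, ‖X' ω - resolvent T lam (X ω)‖ ^ 2 ∂P ≤
      C * τ ^ 2 * (∫ ω, ‖X ω - x₁‖ ^ 2 ∂P + 1)) :
    ∫ ω, ‖X' ω - x₁‖ ^ 2 ∂P + 1 ≤ (1 + (1 + 2 * C) * τ) * (∫ ω, ‖X ω - x₁‖ ^ 2 ∂P + 1) -
      lam ^ 2 * ∫ ω, ‖yosida T lam (X ω)‖ ^ 2 ∂P := by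
  have i1 := (hX.sub (memLp_const x₁)).integrable_norm_sq.const_mul (1 + τ)
  have i2 := (memLp_yosida hT hlam hx₁ hX).integrable_norm_sq.const_mul (lam ^ 2)
  have i3 := (hX'.sub (memLp_resolvent hT hlam hx₁ hX)).integrable_norm_sq.const_mul (1 + τ⁻¹)
  have hpt : ∀ ω, ‖X' ω - x₁‖ ^ 2 ≤ (1 + τ) * ‖X ω - x₁‖ ^ 2 -
      lam ^ 2 * ‖yosida T lam (X ω)‖ ^ 2 + (1 + τ⁻¹) * ‖X' ω - resolvent T lam (X ω)‖ ^ 2 := by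
    intro ω
    have h1 := norm_resolvent_sub_sq_add_le_of_zero_mem hT hlam hx₁ (X ω)
    set J := resolvent T lam (X ω)
    have h2 : ‖X' ω - x₁‖ ≤ ‖X' ω - J‖ + ‖J - x₁‖ := norm_sub_le_norm_sub_add_norm_sub _ _ _
    have h3 : ‖X' ω - x₁‖ ^ 2 ≤ (‖X' ω - J‖ + ‖J - x₁‖) ^ 2 :=
      pow_le_pow_left₀ (norm_nonneg _) h2 2
    have h4 : 0 ≤ τ⁻¹ * (‖X' ω - J‖ - τ * ‖J - x₁‖) ^ 2 := by positivity
    have h5 : τ⁻¹ * (‖X' ω - J‖ - τ * ‖J - x₁‖) ^ 2 =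
        τ⁻¹ * ‖X' ω - J‖ ^ 2 - 2 * ‖X' ω - J‖ * ‖J - x₁‖ + τ * ‖J - x₁‖ ^ 2 := by
      field_simp
      ring
    have h6 : 0 ≤ lam ^ 2 * ‖yosida T lam (X ω)‖ ^ 2 := by positivity
    nlinarith [mul_nonneg hτ.le h6, mul_le_mul_of_nonneg_left h1 (by linarith : 0 ≤ 1 + τ)]
  have hint := (integral_mono (hX'.sub (memLp_const x₁)).integrable_norm_sq
    ((i1.sub i2).add i3) hpt).trans_eq (show _ = (1 + τ) * ∫ ω, ‖X ω - x₁‖ ^ 2 ∂P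
      - lam ^ 2 * ∫ ω, ‖yosida T lam (X ω)‖ ^ 2 ∂P
      + (1 + τ⁻¹) * ∫ ω, ‖X' ω - resolvent T lam (X ω)‖ ^ 2 ∂P by
    rw [← integral_const_mul, ← integral_const_mul, ← integral_const_mul, ← integral_sub,
      ← integral_add]
    exacts [rfl, i1.sub i2, i3, i1, i2])
  simp only [Pi.sub_apply] at hint
  have hR0 : 0 ≤ ∫ ω, ‖X ω - x₁‖ ^ 2 ∂P := integral_nonneg fun _ => by positivity
  set R := ∫ ω, ‖X ω - x₁‖ ^ 2 ∂P
  have h1 : (1 + τ⁻¹) * ∫ ω, ‖X' ω - resolvent T lam (X ω)‖ ^ 2 ∂P ≤ 2 * C * τ * (R + 1) := by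
    calc (1 + τ⁻¹) * ∫ ω, ‖X' ω - resolvent T lam (X ω)‖ ^ 2 ∂P
        ≤ (1 + τ⁻¹) * (C * τ ^ 2 * (R + 1)) := mul_le_mul_of_nonneg_left herr (by positivity)
      _ = C * τ * (R + 1) * (1 + τ) := by
        field_simp
        ring
      _ ≤ C * τ * (R + 1) * 2 := mul_le_mul_of_nonneg_left (by linarith) (by positivity)
      _ = 2 * C * τ * (R + 1) := by ring
  linarith

theorem integral_norm_yosida_sq_le_add {T : E → Set E} (hT : IsMaximalMonotone T)
    (hlam : 0 < lam) {x₁ : E} (hx₁ : 0 ∈ T x₁) {X X' : Ω → E} (hX : MemLp X 2 P)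
    (hX' : MemLp X' 2 P) :
    ∫ ω, ‖yosida T lam (X' ω)‖ ^ 2 ∂P ≤ ∫ ω, ‖yosida T lam (X ω)‖ ^ 2 ∂P +
      (lam ^ 2)⁻¹ * ∫ ω, ‖X' ω - resolvent T lam (X ω)‖ ^ 2 ∂P := by
  have i1 := (memLp_yosida hT hlam hx₁ hX).integrable_norm_sq
  have i2 := (hX'.sub (memLp_resolvent hT hlam hx₁ hX)).integrable_norm_sq.const_mul (lam ^ 2)⁻¹
  rw [← integral_const_mul, ← integral_add]
  exacts [integral_mono (memLp_yosida hT hlam hx₁ hX').integrable_norm_sq (i1.add i2)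
    fun ω => norm_yosida_sq_le_add hT hlam (X ω) (X' ω), i1, i2]

/-- The rate of an inexact proximal-point method whose `k`-th step has relative mean squared error
`O((k + 1) ^ (-2 a))` with `a > 1`. -/
theorem exists_integral_norm_yosida_sq_le_div {T : E → Set E} (hT : IsMaximalMonotone T)
    (hlam : 0 < lam) {x₁ : E} (hx₁ : 0 ∈ T x₁) {a : ℝ} (ha : 1 < a) {x : ℕ → Ω → E}
    (hx : ∀ k, MemLp (x k) 2 P) {C : ℝ} (hC : 0 ≤ C)
    (herr : ∀ k : ℕ, ∫ ω, ‖x (k + 1) ω - resolvent T lam (x k ω)‖ ^ 2 ∂P ≤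
      C * (((k : ℝ) + 1) ^ (-a)) ^ 2 * (∫ ω, ‖x k ω - x₁‖ ^ 2 ∂P + 1)) :
    ∃ C' : ℝ, ∀ k : ℕ, ∫ ω, ‖yosida T lam (x k ω)‖ ^ 2 ∂P ≤ C' / ((k : ℝ) + 1) := by
  set τ : ℕ → ℝ := fun k => ((k : ℝ) + 1) ^ (-a)
  have hτs : Summable τ := summable_add_one_rpow_neg ha
  have hτ0 : ∀ k, 0 < τ k := fun k => by positivity
  have hτ1 : ∀ k : ℕ, ((k : ℝ) + 1) * τ k ≤ 1 := fun k => by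
    have h1 : τ k ≤ ((k : ℝ) + 1) ^ (-1 : ℝ) :=
      Real.rpow_le_rpow_of_exponent_le (by simp) (by linarith)
    rw [Real.rpow_neg_one] at h1
    rwa [← le_inv_mul_iff₀ (by positivity), mul_one]
  have hτ1' : ∀ k, τ k ≤ 1 := fun k =>
    le_trans (le_mul_of_one_le_left (hτ0 k).le (by simp)) (hτ1 k)
  have hR0 : ∀ k, 0 ≤ ∫ ω, ‖x k ω - x₁‖ ^ 2 ∂P := fun k => integral_nonneg fun _ => by positivity
  have hy0 : ∀ k, 0 ≤ ∫ ω, ‖yosida T lam (x k ω)‖ ^ 2 ∂P :=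
    fun k => integral_nonneg fun _ => by positivity
  obtain ⟨H, hH1, hH2⟩ := exists_bound_of_le_one_add_mul_sub
    (u := fun k => ∫ ω, ‖x k ω - x₁‖ ^ 2 ∂P + 1)
    (y := fun k => lam ^ 2 * ∫ ω, ‖yosida T lam (x k ω)‖ ^ 2 ∂P)
    (τ := fun k => (1 + 2 * C) * τ k) (fun k => by linarith [hR0 k])
    (fun k => mul_nonneg (sq_nonneg _) (hy0 k))
    (fun k => mul_nonneg (by positivity) (hτ0 k).le) (hτs.mul_left _)
    fun k => integral_norm_sub_sq_le_of_inexact_step hT hlam hx₁ (hx k) (hx (k + 1)) hC (hτ0 k)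
      (hτ1' k) (herr k)
  have hH0 : 0 ≤ H := by linarith [hH1 0, hR0 0]
  refine exists_le_div_of_sum_le (δ := fun k => (lam ^ 2)⁻¹ * C * H * τ k ^ 2)
    (H := (lam ^ 2)⁻¹ * H) (fun k => by positivity) ?_ (fun k => ?_) fun K => ?_
  · refine Summable.of_nonneg_of_le (fun k => by positivity) (fun k => ?_)
      (hτs.mul_left ((lam ^ 2)⁻¹ * C * H))
    calc ((k : ℝ) + 1) * ((lam ^ 2)⁻¹ * C * H * τ k ^ 2)
        = (lam ^ 2)⁻¹ * C * H * τ k * (((k : ℝ) + 1) * τ k) := by ring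
      _ ≤ (lam ^ 2)⁻¹ * C * H * τ k * 1 :=
        mul_le_mul_of_nonneg_left (hτ1 k) (mul_nonneg (by positivity) (hτ0 k).le)
      _ = (lam ^ 2)⁻¹ * C * H * τ k := mul_one _
  · refine (integral_norm_yosida_sq_le_add hT hlam hx₁ (hx k) (hx (k + 1))).trans ?_
    have h1 := (herr k).trans (mul_le_mul_of_nonneg_left (hH1 k) (by positivity))
    have h2 := mul_le_mul_of_nonneg_left h1 (by positivity : 0 ≤ (lam ^ 2)⁻¹)
    linarith
  · have h1 := hH2 K
    rw [← Finset.mul_sum] at h1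
    rwa [← div_eq_inv_mul, le_div_iff₀' (by positivity)]

variable {S : Type*} [MeasurableSpace E] [BorelSpace E] [MeasurableSpace S] {μ : Measure S}
  [IsProbabilityMeasure μ] {Φ : E → S → Set E} {D : Set E} {v : E → S → E} {M₁ M₂ : ℝ}

/-- The last inner iterate approximates the exact proximal step with mean squared error
`O(1 / N k)`, relative to the mean squared distance of the outer iterate to a solution. -/
theorem exists_integral_iterate_succ_sub_resolvent_le
    (hT : IsMaximalMonotone (expectedMap μ Φ)) {x₁ : E} (hx₁ : 0 ∈ expectedMap μ Φ x₁)
    (hv : IsOracle μ Φ D v M₁ M₂) {θ : ℝ} (hlam : 0 < lam) (hθ : lam < θ)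
    {α : ℕ → ℝ} (hα₀ : 0 ≤ α 0) (hα : ∀ j : ℕ, 1 ≤ j → α j = θ / j)
    {N : ℕ → ℕ} (hN : ∀ k, 1 ≤ N k) {x₀ : E}
    {ξ : ℕ → ℕ → Ω → S} (hξ : ∀ k j, Measurable (ξ k j)) (hlaw : ∀ k j, P.map (ξ k j) = μ)
    (hindep : iIndepFun (fun p : ℕ × ℕ => ξ p.1 p.2) P)
    (hD : ∀ k j : ℕ, j < N k → ∀ᵐ ω ∂P,
      innerIterate v lam α N x₀ (fun k j => ξ k j ω) k j ∈ D) :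
    ∃ C : ℝ, 0 ≤ C ∧ ∀ k : ℕ,
      MemLp (fun ω => iterate v lam α N x₀ (fun k j => ξ k j ω) k) 2 P ∧
      ∫ ω, ‖iterate v lam α N x₀ (fun k j => ξ k j ω) (k + 1) - resolvent (expectedMap μ Φ) lam
          (iterate v lam α N x₀ (fun k j => ξ k j ω) k)‖ ^ 2 ∂P ≤
        C * (∫ ω, ‖iterate v lam α N x₀ (fun k j => ξ k j ω) k - x₁‖ ^ 2 ∂P + 1) / N k := by
  have hαn : ∀ j, 0 ≤ α j := fun j => by
    rcases Nat.eq_zero_or_pos j with rfl | hj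
    · exact hα₀
    · rw [hα j hj]
      have := hlam.trans hθ
      positivity
  have hρθ : 2 < 2 * lam⁻¹ * θ := by
    have : 1 < lam⁻¹ * θ := by
      rwa [inv_mul_eq_div, one_lt_div hlam]
    linarith
  obtain ⟨C, hC0, hC⟩ := exists_le_div_of_recursion
    (A := 9 * M₁ ^ 2 + 3 * lam⁻¹ ^ 2) (ρ := 2 * lam⁻¹)
    (B := 9 * M₁ ^ 2 * (1 + ‖x₁‖ ^ 2) + 3 * M₂ ^ 2 + 3 * lam⁻¹ ^ 2) (by positivity)
    (by positivity) (by positivity) hρθ hαn hα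
  set x : ℕ → Ω → E := fun k ω => iterate v lam α N x₀ (fun k j => ξ k j ω) k
  set z : ℕ → ℕ → Ω → E := fun k j ω => innerIterate v lam α N x₀ (fun k j => ξ k j ω) k j
  have hxm : ∀ k, Measurable (x k) := fun k => measurable_iterate hv.measurable k fun i _ => hξ i
  have hzm : ∀ k j, Measurable (z k j) := fun k j =>
    measurable_innerIterate hv.measurable k j (fun i _ => hξ i) fun i _ => hξ k i
  have hstep := fun k j (hj : j < N k) (hx2 : MemLp (x k) 2 P) (hz2 : MemLp (z k j) 2 P) =>
    integral_saStep_le hT hlam hx₁ hv (hαn j) (hxm k) (hzm k j) (hξ k j) (hlaw k j)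
      (indepFun_innerIterate hv.measurable hξ hindep k j) (hD k j hj) hx2 hz2
  have hz2 : ∀ k, MemLp (x k) 2 P → ∀ j ≤ N k, MemLp (z k j) 2 P := by
    intro k hx2 j
    induction j with
    | zero => exact fun _ => hx2
    | succ j ih => exact fun hj => (hstep k j hj hx2 (ih (by omega))).1
  have hx2 : ∀ k, MemLp (x k) 2 P := by
    intro k
    induction k with
    | zero => exact memLp_const x₀
    | succ k ih => exact hz2 k ih (N k) le_rfl
  refine ⟨C, hC0, fun k => ⟨hx2 k, ?_⟩⟩
  have hR0 : 0 ≤ ∫ ω, ‖x k ω - x₁‖ ^ 2 ∂P := integral_nonneg fun _ => by positivity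
  refine hC (N k) (fun j => ∫ ω, ‖z k j ω - resolvent (expectedMap μ Φ) lam (x k ω)‖ ^ 2 ∂P)
    (∫ ω, ‖x k ω - x₁‖ ^ 2 ∂P + 1) (hN k) (by linarith)
    (fun j => integral_nonneg fun _ => by positivity) ?_
    fun j hj => (hstep k j hj (hx2 k) (hz2 k (hx2 k) j hj.le)).2
  -- The inner scheme starts at `z k 0 = x k`, and `x - J x = lam • Y x`.
  have h0 : ∫ ω, ‖z k 0 ω - resolvent (expectedMap μ Φ) lam (x k ω)‖ ^ 2 ∂P ≤
      ∫ ω, ‖x k ω - x₁‖ ^ 2 ∂P := by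
    refine integral_mono ((hx2 k).sub (memLp_resolvent hT hlam hx₁ (hx2 k))).integrable_norm_sq
      ((hx2 k).sub (memLp_const x₁)).integrable_norm_sq fun ω => ?_
    have h1 := norm_resolvent_sub_sq_add_le_of_zero_mem hT hlam hx₁ (x k ω)
    have h2 : ‖x k ω - resolvent (expectedMap μ Φ) lam (x k ω)‖ ^ 2 =
        lam ^ 2 * ‖yosida (expectedMap μ Φ) lam (x k ω)‖ ^ 2 := by
      rw [← smul_yosida hlam, norm_smul, mul_pow, Real.norm_eq_abs, sq_abs]
    change ‖x k ω - resolvent (expectedMap μ Φ) lam (x k ω)‖ ^ 2 ≤ ‖x k ω - x₁‖ ^ 2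
    rw [h2]
    exact le_trans (le_add_of_nonneg_left (sq_nonneg _)) h1
  linarith

end OuterScheme

end VRSPP

theorem mainTheorem2 {n : ℕ} {S Ω : Type*} [MeasurableSpace S] [MeasurableSpace Ω]
    (μ : Measure S) [IsProbabilityMeasure μ] (P : Measure Ω) [IsProbabilityMeasure P]
    -- the random set-valued map, the inclusion `0 ∈ T(x) = 𝔼[Φ(x, ω)]`, and its solvability
    (Φ : EuclideanSpace ℝ (Fin n) → S → Set (EuclideanSpace ℝ (Fin n)))
    (hT : VRSPP.IsMaximalMonotone (VRSPP.expectedMap μ Φ))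
    (hsol : ∃ x, 0 ∈ VRSPP.expectedMap μ Φ x)
    -- the stochastic first-order oracle
    (D : Set (EuclideanSpace ℝ (Fin n)))
    (v : EuclideanSpace ℝ (Fin n) → S → EuclideanSpace ℝ (Fin n)) (M₁ M₂ : ℝ)
    (hv : VRSPP.IsOracle μ Φ D v M₁ M₂)
    -- the parameters of the scheme
    (lam a θ : ℝ) (hlam : 0 < lam) (ha : 1 < a) (hθ : lam < θ)
    (α : ℕ → ℝ) (hα₀ : 0 ≤ α 0) (hα : ∀ j : ℕ, 1 ≤ j → α j = θ / j)
    (x₀ : EuclideanSpace ℝ (Fin n))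
    -- the independent samples with law `μ`
    (ξ : ℕ → ℕ → Ω → S) (hξ : ∀ k j, Measurable (ξ k j)) (hlaw : ∀ k j, P.map (ξ k j) = μ)
    (hindep : iIndepFun (fun p : ℕ × ℕ => ξ p.1 p.2) P)
    -- all the oracle queries of the scheme are made in `D` (no condition if `D = Set.univ`)
    (hD : ∀ k j : ℕ, j < VRSPP.sampleSize a k → ∀ᵐ ω ∂P,
      VRSPP.innerIterate v lam α (VRSPP.sampleSize a) x₀ (fun k j => ξ k j ω) k j ∈ D) :
    -- the resolvent is well defined
    (∀ x, VRSPP.resolventSet (VRSPP.expectedMap μ Φ) lam x =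
      {VRSPP.resolvent (VRSPP.expectedMap μ Φ) lam x}) ∧
    -- (a) the rate
    (∃ C : ℝ, ∀ k : ℕ,
      Integrable (fun ω => ‖VRSPP.yosida (VRSPP.expectedMap μ Φ) lam
        (VRSPP.iterate v lam α (VRSPP.sampleSize a) x₀ (fun k j => ξ k j ω) k)‖ ^ 2) P ∧
      ∫ ω, ‖VRSPP.yosida (VRSPP.expectedMap μ Φ) lam
        (VRSPP.iterate v lam α (VRSPP.sampleSize a) x₀ (fun k j => ξ k j ω) k)‖ ^ 2 ∂P
          ≤ C / ((k : ℝ) + 1)) ∧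
    -- (b) the oracle complexity
    (∃ C : ℝ, ∀ ε : ℝ, 0 < ε → ε ≤ 1 → ∃ K : ℕ,
      ∫ ω, ‖VRSPP.yosida (VRSPP.expectedMap μ Φ) lam
        (VRSPP.iterate v lam α (VRSPP.sampleSize a) x₀ (fun k j => ξ k j ω) (K + 1))‖ ^ 2 ∂P
          ≤ ε ∧
      ∑ k ∈ Finset.range (K + 1), (VRSPP.sampleSize a k : ℝ) ≤ C / ε ^ (2 * a + 1)) := by
  obtain ⟨x₁, hx₁⟩ := hsol
  obtain ⟨C, hC0, hC⟩ := VRSPP.exists_integral_iterate_succ_sub_resolvent_le hT hx₁ hv hlam hθ hα₀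
    hα (VRSPP.one_le_sampleSize a) hξ hlaw hindep hD
  obtain ⟨C', hC'⟩ := VRSPP.exists_integral_norm_yosida_sq_le_div hT hlam hx₁ ha
    (fun k => (hC k).1) hC0 fun k => by
      refine (hC k).2.trans ?_
      have hR : 0 ≤ ∫ ω, ‖VRSPP.iterate v lam α (VRSPP.sampleSize a) x₀
          (fun k j => ξ k j ω) k - x₁‖ ^ 2 ∂P := integral_nonneg fun _ => by positivity
      rw [div_eq_mul_inv, mul_right_comm]
      gcongr
      exact VRSPP.inv_sampleSize_le a k
  refine ⟨VRSPP.resolventSet_eq_singleton hT hlam, ⟨C', fun k =>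
    ⟨(VRSPP.memLp_yosida hT hlam hx₁ (hC k).1).integrable_norm_sq, hC' k⟩⟩, ?_⟩
  obtain ⟨C'', hC''⟩ := VRSPP.exists_sum_sampleSize_le (a := a) (by linarith) (le_max_right C' 0)
  refine ⟨C'', fun ε hε hε1 => ?_⟩
  obtain ⟨K, hK, hsum⟩ := hC'' ε hε hε1
  refine ⟨K, (hC' (K + 1)).trans (le_trans ?_ hK), hsum⟩
  gcongr
  exact le_max_left _ _
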